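/- Let $G$ be a finitely generated group with identity $e$, let $|\cdot|$ be the word length on $G$ with respect to some finite generating set, and let $\mu$ be a probability measure on $G$, i.e. a function $\mu:G\to[0,\infty)$ with $\sum_{g\in G}\mu(g)=1$. Suppose that $\mu$ is non-degenerate, i.e. that its support $\{g\in G:\mu(g)>0\}$ generates $G$ as a semigroup, and that $\mu$ has a finite exponential moment of some order, i.e. that $\sum_{g\in G}e^{c|g|}\mu(g)<\infty$ for some $c>0$. Let $\mu^{*n}$ be the $n$-fold convolution power of $\mu$, where $(\mu*\nu)(g)=\sum_{s\in G}\mu(s)\,\nu(s^{-1}g)$, and let $$\lambda(G,\mu)=\limsup_{n\to\infty}\bigl(\mu^{*n}(e)\bigr)^{1/n}.$$ Then $\lambda(G,\mu)=1$ if and only if $G$ is amenable and $\mu$ is centred. Here $G$ is amenable if there is a linear functional $M:\ell^\infty(G)\to\mathbb R$ (a Banach mean) with $M(\mathbf 1)=1$, $\inf_{g\in G}f(g)\le M(f)\le\sup_{g\in G}f(g)$ and $M(f_g)=M(f)$ for all $f\in\ell^\infty(G)$ and $g\in G$, where $\ell^\infty(G)$ is the space of bounded real-valued functions on $G$ and $f_g(x)=f(gx)$;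 and $\mu$ is centred if $\sum_{g\in G}\chi(g)\mu(g)=0$ for every homomorphism $\chi:G\to(\mathbb R,+)$. -/

import Mathlib

open Filter
open scoped ENNReal

namespace GroupWalk

/-- A probability measure on a discrete group `G`, given by its mass function `μ : G → ℝ`:
nonnegative values with (unconditionally convergent) total sum `1`. -/
structure IsProbability {G : Type*} (μ : G → ℝ) : Prop where
  nonneg : ∀ g, 0 ≤ μ g
  hasSum_one : HasSum μ 1

/-- `μ` is non-degenerate if its support `{g | 0 < μ g}` generates `G` as a semigroup. -/
def IsNondegenerate {G : Type*} [Group G] (μ : G → ℝ) : Prop :=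
  Subsemigroup.closure {g : G | 0 < μ g} = ⊤

/-- The word length of `g` with respect to `S`: the least length of a word in the elements of `S`
and their inverses whose product is `g`. (The infimum is over a non-empty set for every `g` when
`S` generates `G` as a group.) -/
noncomputable def wordLength {G : Type*} [Group G] (S : Set G) (g : G) : ℕ :=
  sInf {n : ℕ | ∃ l : List G, (∀ x ∈ l, x ∈ S ∨ x⁻¹ ∈ S) ∧ l.prod = g ∧ l.length = n}

/-- `μ` has finite exponential moment of order `c`, for the word length of `S`. -/
def HasExpMoment {G : Type*} [Group G] (S : Set G) (μ : G → ℝ) (c : ℝ) : Prop :=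
  Summable fun g : G => Real.exp (c * (wordLength S g : ℝ)) * μ g

/-- The convolution `(μ ∗ ν)(g) = ∑ₛ μ(s) ν(s⁻¹ g)`. The series converges for all mass functions of
probability measures. -/
noncomputable def conv {G : Type*} [Group G] (μ ν : G → ℝ) (g : G) : ℝ :=
  ∑' s : G, μ s * ν (s⁻¹ * g)

open Classical in
/-- The convolution powers of `μ`; the zeroth one is the unit mass at the identity. -/
noncomputable def convPow {G : Type*} [Group G] (μ : G → ℝ) : ℕ → G → ℝ
  | 0 => fun g => if g = 1 then 1 else 0
  | n + 1 => conv μ (convPow μ n)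

/-- The spectral radius `λ(G, μ) = limsup (μ^{∗n}(e))^{1/n}`. For a probability measure the
sequence takes values in `[0, 1]`, so this is the genuine upper limit. -/
noncomputable def walkSpectralRadius {G : Type*} [Group G] (μ : G → ℝ) : ℝ :=
  limsup (fun n : ℕ => (convPow μ n 1) ^ (1 / (n : ℝ))) atTop

/-- The translate `f_g(x) = f(g x)` of a bounded function `f ∈ ℓ^∞(G)`. -/
def translate {G : Type*} [Group G] (g : G) (f : lp (fun _ : G => ℝ) ∞) :
    lp (fun _ : G => ℝ) ∞ :=
  ⟨fun x => f (g * x), by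
    obtain ⟨C, hC⟩ := memℓp_infty_iff.1 (lp.memℓp f)
    refine memℓp_infty ⟨C, ?_⟩
    rintro _ ⟨x, rfl⟩
    exact hC ⟨g * x, rfl⟩⟩

/-- A Banach mean on `G`: a linear functional `M` on the bounded real functions on `G` with
`M 1 = 1`, `inf f ≤ M f ≤ sup f`, and invariant under translation. -/
structure IsBanachMean {G : Type*} [Group G] (M : lp (fun _ : G => ℝ) ∞ →ₗ[ℝ] ℝ) : Prop where
  map_one : M 1 = 1
  iInf_le : ∀ f : lp (fun _ : G => ℝ) ∞, (⨅ g : G, f g) ≤ M f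
  le_iSup : ∀ f : lp (fun _ : G => ℝ) ∞, M f ≤ ⨆ g : G, f g
  map_translate : ∀ (g : G) (f : lp (fun _ : G => ℝ) ∞), M (translate g f) = M f

/-- The discrete group `G` is amenable if it admits a Banach mean. -/
def IsAmenable (G : Type*) [Group G] : Prop :=
  ∃ M : lp (fun _ : G => ℝ) ∞ →ₗ[ℝ] ℝ, IsBanachMean M

/-- `μ` is centred if every homomorphism `χ : G → (ℝ, +)` has mean zero, the series
`∑ χ(g) μ(g)` being (absolutely) convergent. -/
def IsCentred {G : Type*} [Group G] (μ : G → ℝ) : Prop :=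
  ∀ χ : Additive G →+ ℝ, HasSum (fun g : G => χ (Additive.ofMul g) * μ g) 0

end GroupWalk

/-!
The walk has spectral radius `1` exactly when nothing forces exponential decay of its return
probabilities; the two possible obstructions are a drift along a homomorphism to `ℝ` and a spectral
gap of the regular representation.

*Amenable and centred implies spectral radius one.* If `λ(G, μ) < t`, the Green function
`h = ∑ t⁻ⁿ μ^{∗n}` is finite, positive and satisfies `∑ μ(s) h(s⁻¹ x) ≤ t h(x)`
(`sum_mul_greenFunction_le`), and non-degeneracy gives a Harnack inequality
(`exists_greenFunction_le`). Hence `x ↦ log (h(g x) / h(x))` is bounded for each `g`. Its mean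
`χ(g)` is a homomorphism, since the increments of `log h` form a cocycle and the mean is invariant
(`meanIncrement`). Averaging `1 + log y ≤ y` at `y = h(s⁻¹ x) / h(x)` yields
`∑ μ(s) (1 - χ(s)) ≤ t`, and the left-hand side is `1` because `μ` is centred
(`one_le_of_isAmenable_of_isCentred`).

*Spectral radius one implies centred.* If a homomorphism `χ` has nonzero mean, then
`F = ∑ e^{tχ} μ < 1` for some small `t` (`exists_hasSum_exp_lt_one`; this uses the exponential
moment), and conjugation by the character `e^{tχ}` gives `μ^{∗n}(e) ≤ Fⁿ` (`convPow_mul_le_pow`).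

*Spectral radius one implies amenable.* Let `P` be convolution by `μ` on `ℓ²(G)`. The middle term
of the binomial expansion of `(1 + P)²ⁿ` gives `C(2n, n) μ^{∗n}(e) ≤ ‖1 + P‖²ⁿ`
(`centralBinom_mul_convPow_le`), so spectral radius one forces `‖1 + P‖ = 2`. Working with `1 + P`
instead of `P` rules out periodicity: unit vectors that nearly attain this norm are almost fixed by
the support of `μ`, not only by its quotients `s⁻¹ s'` (`mul_norm_leftRegular_sub_sq_le`). They are
then almost fixed by all of `G`, and a limit of the averages against their squares along an
ultrafilter is a Banach mean (`isAmenable_of_almost_invariant`).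
-/

namespace GroupWalk

variable {G : Type*} [Group G] {μ : G → ℝ}

/-! ### Convolution powers -/

lemma convPow_nonneg (hμ : ∀ g, 0 ≤ μ g) (n : ℕ) (g : G) : 0 ≤ convPow μ n g := by
  induction n generalizing g with
  | zero => simp only [convPow]; split_ifs <;> norm_num
  | succ n ih => exact tsum_nonneg fun s => mul_nonneg (hμ s) (ih _)

lemma convPow_zero_one : convPow μ 0 1 = 1 := by simp [convPow]

/-- Conjugating the walk by a positive character `w` multiplies the mass by at most
`F = ∑ w μ` in each step. -/
lemma convPow_mul_le_pow (hμ : ∀ g, 0 ≤ μ g) (w : G →* ℝ) (hw : ∀ g, 0 < w g) {F : ℝ}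
    (hF : HasSum (fun g => w g * μ g) F) (n : ℕ) (g : G) :
    convPow μ n g * w g ≤ F ^ n := by
  induction n generalizing g with
  | zero =>
    simp only [convPow, pow_zero]
    split_ifs with h
    · simp [h]
    · simp
  | succ n ih =>
    have hle : ∀ s, μ s * convPow μ n (s⁻¹ * g) * w g ≤ w s * μ s * F ^ n := fun s => by
      have hg : w g = w s * w (s⁻¹ * g) := by rw [← map_mul, mul_inv_cancel_left]
      calc μ s * convPow μ n (s⁻¹ * g) * w g
          = w s * μ s * (convPow μ n (s⁻¹ * g) * w (s⁻¹ * g)) := by rw [hg]; ring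
        _ ≤ _ := mul_le_mul_of_nonneg_left (ih _) (mul_nonneg (hw s).le (hμ s))
    have hsum := hF.mul_right (F ^ n)
    have hs : Summable fun s => μ s * convPow μ n (s⁻¹ * g) * w g :=
      .of_nonneg_of_le (fun s => mul_nonneg (mul_nonneg (hμ s) (convPow_nonneg hμ _ _)) (hw g).le)
        hle hsum.summable
    calc convPow μ (n + 1) g * w g = ∑' s, μ s * convPow μ n (s⁻¹ * g) * w g := by
          rw [tsum_mul_right]; rfl
      _ ≤ F * F ^ n := hasSum_le hle hs.hasSum hsum
      _ = F ^ (n + 1) := by ring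

lemma convPow_le_one (hμ : IsProbability μ) (n : ℕ) (g : G) : convPow μ n g ≤ 1 := by
  simpa using convPow_mul_le_pow (F := 1) hμ.nonneg (1 : G →* ℝ) (by simp)
    (by simpa using hμ.hasSum_one) n g

lemma summable_mul_convPow (hμ : IsProbability μ) (n : ℕ) (g : G) :
    Summable fun s => μ s * convPow μ n (s⁻¹ * g) :=
  .of_nonneg_of_le (fun s => mul_nonneg (hμ.nonneg s) (convPow_nonneg hμ.nonneg _ _))
    (fun s => mul_le_of_le_one_right (hμ.nonneg s) (convPow_le_one hμ _ _)) hμ.hasSum_one.summable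

lemma sum_mul_convPow_le (hμ : IsProbability μ) (F : Finset G) (n : ℕ) (g : G) :
    ∑ s ∈ F, μ s * convPow μ n (s⁻¹ * g) ≤ convPow μ (n + 1) g :=
  (summable_mul_convPow hμ n g).sum_le_tsum F
    fun s _ => mul_nonneg (hμ.nonneg s) (convPow_nonneg hμ.nonneg _ _)

lemma mul_convPow_le (hμ : IsProbability μ) (s : G) (n : ℕ) (g : G) :
    μ s * convPow μ n (s⁻¹ * g) ≤ convPow μ (n + 1) g := by
  simpa using sum_mul_convPow_le hμ {s} n g

/-! ### The spectral radius -/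

lemma rpow_one_div_le_one (hμ : IsProbability μ) (n : ℕ) :
    (convPow μ n 1) ^ (1 / (n : ℝ)) ≤ 1 :=
  Real.rpow_le_one (convPow_nonneg hμ.nonneg _ _) (convPow_le_one hμ _ _) (by positivity)

lemma rpow_one_div_nonneg (hμ : IsProbability μ) (n : ℕ) :
    0 ≤ (convPow μ n 1) ^ (1 / (n : ℝ)) :=
  Real.rpow_nonneg (convPow_nonneg hμ.nonneg _ _) _

lemma walkSpectralRadius_le (hμ : IsProbability μ) {r : ℝ}
    (h : ∀ᶠ n in atTop, (convPow μ n 1) ^ (1 / (n : ℝ)) ≤ r) : walkSpectralRadius μ ≤ r :=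
  limsup_le_of_le (IsBoundedUnder.isCoboundedUnder_le
    (isBoundedUnder_of ⟨0, rpow_one_div_nonneg hμ⟩)) h

lemma walkSpectralRadius_le_one (hμ : IsProbability μ) : walkSpectralRadius μ ≤ 1 :=
  walkSpectralRadius_le hμ (.of_forall (rpow_one_div_le_one hμ))

lemma walkSpectralRadius_nonneg (hμ : IsProbability μ) : 0 ≤ walkSpectralRadius μ :=
  le_limsup_of_frequently_le (.of_forall (rpow_one_div_nonneg hμ))
    (isBoundedUnder_of ⟨1, rpow_one_div_le_one hμ⟩)

lemma walkSpectralRadius_lt_one_of_le (hμ : IsProbability μ) {r : ℝ} (hr0 : 0 ≤ r) (hr1 : r < 1)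
    (h : ∀ n : ℕ, convPow μ n 1 ≤ (2 * n + 1) * r ^ n) : walkSpectralRadius μ < 1 := by
  obtain ⟨q, hrq, hq1⟩ := exists_between hr1
  have hq0 : 0 < q := hr0.trans_lt hrq
  have hlim : Tendsto (fun n : ℕ => (2 * n + 1) * (r / q) ^ n) atTop (nhds 0) := by
    have h1 := tendsto_self_mul_const_pow_of_lt_one (div_nonneg hr0 hq0.le) ((div_lt_one hq0).2 hrq)
    have h2 := tendsto_pow_atTop_nhds_zero_of_lt_one (div_nonneg hr0 hq0.le) ((div_lt_one hq0).2 hrq)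
    have h3 := (h1.const_mul 2).add h2
    simp only [mul_zero, add_zero] at h3
    exact h3.congr fun n => by ring
  refine (walkSpectralRadius_le hμ ?_).trans_lt hq1
  filter_upwards [hlim.eventually (gt_mem_nhds one_pos), eventually_ne_atTop 0] with n hn hn0
  have hle : convPow μ n 1 ≤ q ^ n := (h n).trans (by
    rw [div_pow, ← mul_div_assoc, div_lt_one (by positivity)] at hn
    exact hn.le)
  calc (convPow μ n 1) ^ (1 / (n : ℝ)) ≤ (q ^ n) ^ (1 / (n : ℝ)) :=
        Real.rpow_le_rpow (convPow_nonneg hμ.nonneg _ _) hle (by positivity)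
    _ = q := by rw [one_div, Real.pow_rpow_inv_natCast hq0.le hn0]

lemma summable_inv_pow_mul_convPow_one (hμ : IsProbability μ) {t : ℝ}
    (ht : walkSpectralRadius μ < t) : Summable fun n : ℕ => (t⁻¹) ^ n * convPow μ n 1 := by
  obtain ⟨q, hq, hqt⟩ := exists_between ht
  have hq0 : 0 < q := (walkSpectralRadius_nonneg hμ).trans_lt hq
  have ht0 : 0 < t := hq0.trans hqt
  have hev : ∀ᶠ n : ℕ in atTop, (convPow μ n 1) ^ (1 / (n : ℝ)) < q :=
    eventually_lt_of_limsup_lt hq (isBoundedUnder_of ⟨1, rpow_one_div_le_one hμ⟩)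
  refine Summable.of_norm_bounded_eventually_nat (g := fun n => (q / t) ^ n)
    (summable_geometric_of_lt_one (by positivity) ((div_lt_one ht0).2 hqt)) ?_
  filter_upwards [hev, eventually_ne_atTop 0] with n hn hn0
  have h0 := convPow_nonneg hμ.nonneg n 1
  have : convPow μ n 1 ≤ q ^ n := by
    calc convPow μ n 1 = ((convPow μ n 1) ^ (1 / (n : ℝ))) ^ n := by
          rw [one_div, Real.rpow_inv_natCast_pow h0 hn0]
      _ ≤ q ^ n := pow_le_pow_left₀ (rpow_one_div_nonneg hμ n) hn.le n
  rw [Real.norm_of_nonneg (by positivity), div_eq_inv_mul, mul_pow]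
  gcongr

lemma IsNondegenerate.induction (hnd : IsNondegenerate μ) {p : G → Prop}
    (mem : ∀ s, 0 < μ s → p s) (mul : ∀ g h, p g → p h → p (g * h)) (g : G) : p g := by
  have hg : g ∈ Subsemigroup.closure {g : G | 0 < μ g} := by
    rw [show Subsemigroup.closure {g : G | 0 < μ g} = ⊤ from hnd]; trivial
  induction hg using Subsemigroup.closure_induction with
  | mem x hx => exact mem x hx
  | mul x y _ _ hx hy => exact mul x y hx hy

/-! ### The Green function -/

/-- The Green function of the walk at parameter `t`, i.e. `∑ₙ t⁻ⁿ μ^{∗n}(x)`. -/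
noncomputable def greenFunction (μ : G → ℝ) (t : ℝ) (x : G) : ℝ :=
  ∑' n : ℕ, (t⁻¹) ^ n * convPow μ n x

lemma summable_greenFunction (hμ : IsProbability μ) (hnd : IsNondegenerate μ) {t : ℝ}
    (ht : walkSpectralRadius μ < t) (x : G) :
    Summable fun n : ℕ => (t⁻¹) ^ n * convPow μ n x := by
  have ht0 : 0 < t := (walkSpectralRadius_nonneg hμ).trans_lt ht
  suffices h : ∀ g x : G, (Summable fun n : ℕ => (t⁻¹) ^ n * convPow μ n x) →
      Summable fun n : ℕ => (t⁻¹) ^ n * convPow μ n (g⁻¹ * x) by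
    simpa using h x⁻¹ 1 (summable_inv_pow_mul_convPow_one hμ ht)
  refine hnd.induction (fun s hs x hx => ?_) fun g h hg hh x hx => ?_
  · refine .of_nonneg_of_le
      (fun n => mul_nonneg (by positivity) (convPow_nonneg hμ.nonneg _ _)) (fun n => ?_)
      (((summable_nat_add_iff 1).2 hx).mul_left (t / μ s))
    calc (t⁻¹) ^ n * convPow μ n (s⁻¹ * x)
        = t / μ s * ((t⁻¹) ^ (n + 1) * (μ s * convPow μ n (s⁻¹ * x))) := by rw [pow_succ]; field_simp
      _ ≤ _ := by gcongr; exact mul_convPow_le hμ s n x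
  · simpa [mul_assoc] using hh _ (hg _ hx)

/-- The Green function is superharmonic with eigenvalue `t`. -/
lemma sum_mul_greenFunction_le (hμ : IsProbability μ) (hnd : IsNondegenerate μ) {t : ℝ}
    (ht : walkSpectralRadius μ < t) (F : Finset G) (x : G) :
    ∑ s ∈ F, μ s * greenFunction μ t (s⁻¹ * x) ≤ t * greenFunction μ t x := by
  have ht0 : 0 < t := (walkSpectralRadius_nonneg hμ).trans_lt ht
  have hsum := summable_greenFunction hμ hnd ht
  have h1 := hasSum_sum (s := F) fun s _ => (hsum (s⁻¹ * x)).hasSum.mul_left (μ s)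
  have h2 := (((summable_nat_add_iff 1).2 (hsum x)).hasSum).mul_left t
  refine (hasSum_le (fun n => ?_) h1 h2).trans ?_
  · calc ∑ s ∈ F, μ s * ((t⁻¹) ^ n * convPow μ n (s⁻¹ * x))
        = (t⁻¹) ^ n * ∑ s ∈ F, μ s * convPow μ n (s⁻¹ * x) := by
          rw [Finset.mul_sum]; exact Finset.sum_congr rfl fun s _ => by ring
      _ ≤ (t⁻¹) ^ n * convPow μ (n + 1) x := by gcongr; exact sum_mul_convPow_le hμ F n x
      _ = t * ((t⁻¹) ^ (n + 1) * convPow μ (n + 1) x) := by rw [pow_succ]; field_simp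
  · rw [greenFunction, (hsum x).tsum_eq_zero_add]
    have := convPow_nonneg hμ.nonneg 0 x
    gcongr
    simpa using this

/-- The Harnack inequality for the Green function. -/
lemma exists_greenFunction_le (hμ : IsProbability μ) (hnd : IsNondegenerate μ) {t : ℝ}
    (ht : walkSpectralRadius μ < t) (g : G) :
    ∃ C : ℝ, 0 < C ∧ ∀ x, greenFunction μ t (g⁻¹ * x) ≤ C * greenFunction μ t x := by
  have ht0 : 0 < t := (walkSpectralRadius_nonneg hμ).trans_lt ht
  refine hnd.induction (p := fun g => ∃ C : ℝ, 0 < C ∧ ∀ x, greenFunction μ t (g⁻¹ * x)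
    ≤ C * greenFunction μ t x) (fun s hs => ⟨t / μ s, by positivity, fun x => ?_⟩) ?_ g
  · have := sum_mul_greenFunction_le hμ hnd ht {s} x
    rw [Finset.sum_singleton] at this
    rwa [div_mul_eq_mul_div, le_div_iff₀ hs, mul_comm]
  · rintro g h ⟨C, hC, hg⟩ ⟨D, hD, hh⟩
    refine ⟨D * C, by positivity, fun x => ?_⟩
    rw [mul_inv_rev, mul_assoc, mul_assoc]
    exact (hh _).trans (by gcongr; exact hg x)

lemma greenFunction_pos (hμ : IsProbability μ) (hnd : IsNondegenerate μ) {t : ℝ}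
    (ht : walkSpectralRadius μ < t) (x : G) : 0 < greenFunction μ t x := by
  have ht0 : 0 < t := (walkSpectralRadius_nonneg hμ).trans_lt ht
  have h1 : 1 ≤ greenFunction μ t 1 := by
    have := (summable_greenFunction hμ hnd ht 1).le_tsum 0
      fun n _ => mul_nonneg (by positivity) (convPow_nonneg hμ.nonneg n 1)
    rwa [convPow_zero_one, pow_zero, mul_one] at this
  obtain ⟨C, hC, h⟩ := exists_greenFunction_le hμ hnd ht x
  have := h x
  rw [inv_mul_cancel] at this
  exact pos_of_mul_pos_right (one_pos.trans_le (h1.trans this)) hC.le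

/-! ### Averaging a logarithmic cocycle over an amenable group -/

/-- The function `x ↦ ψ (g x) - ψ x`, as an element of `ℓ^∞(G)`, for a function `ψ` whose
increments under left translations are bounded. -/
def increment (ψ : G → ℝ) (hψ : ∀ g, ∃ C, ∀ x, |ψ (g * x) - ψ x| ≤ C) (g : G) :
    lp (fun _ : G => ℝ) ∞ :=
  ⟨fun x => ψ (g * x) - ψ x, memℓp_infty (by
    obtain ⟨C, hC⟩ := hψ g
    exact ⟨C, by rintro _ ⟨x, rfl⟩; exact hC x⟩)⟩

/-- The mean of the increments of `ψ`. It is additive because `increment ψ` is a cocycle and the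
mean is invariant. -/
noncomputable def meanIncrement {M : lp (fun _ : G => ℝ) ∞ →ₗ[ℝ] ℝ} (hM : IsBanachMean M) (ψ : G → ℝ)
    (hψ : ∀ g, ∃ C, ∀ x, |ψ (g * x) - ψ x| ≤ C) : Additive G →+ ℝ :=
  AddMonoidHom.mk' (fun g => M (increment ψ hψ g.toMul)) fun g k => by
    have h : increment ψ hψ (g + k).toMul
        = translate k.toMul (increment ψ hψ g.toMul) + increment ψ hψ k.toMul := by
      ext x
      change ψ (g.toMul * k.toMul * x) - ψ x
        = (ψ (g.toMul * (k.toMul * x)) - ψ (k.toMul * x)) + (ψ (k.toMul * x) - ψ x)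
      rw [mul_assoc]
      ring
    rw [h, map_add, hM.map_translate]

lemma IsBanachMean.le_of_forall_le {M : lp (fun _ : G => ℝ) ∞ →ₗ[ℝ] ℝ} (hM : IsBanachMean M)
    {f : lp (fun _ : G => ℝ) ∞} {t : ℝ} (h : ∀ x, f x ≤ t) : M f ≤ t :=
  (hM.le_iSup f).trans (ciSup_le h)

/-- The bound `log y ≤ y - 1`, applied to the ratios `h (s⁻¹ x) / h x` of the Green function `h`
and averaged over `x`, gives `∑ μ(s) (1 - χ(s)) ≤ t` for the homomorphism `χ` of mean increments
of `log h`. -/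
lemma one_le_of_isAmenable_of_isCentred (hμ : IsProbability μ) (hnd : IsNondegenerate μ)
    (ha : IsAmenable G) (hc : IsCentred μ) {t : ℝ} (ht : walkSpectralRadius μ < t) : 1 ≤ t := by
  obtain ⟨M, hM⟩ := ha
  set h := greenFunction μ t
  have hpos : ∀ x, 0 < h x := greenFunction_pos hμ hnd ht
  have hψ : ∀ g, ∃ C, ∀ x, |Real.log (h (g * x)) - Real.log (h x)| ≤ C := fun g => by
    obtain ⟨C, hC, h1⟩ := exists_greenFunction_le hμ hnd ht g⁻¹
    obtain ⟨D, hD, h2⟩ := exists_greenFunction_le hμ hnd ht g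
    refine ⟨max (Real.log C) (Real.log D), fun x => abs_le'.2 ⟨?_, ?_⟩⟩
    · have := Real.log_le_log (hpos _) (h1 x)
      rw [Real.log_mul hC.ne' (hpos x).ne', inv_inv] at this
      exact le_max_of_le_left (by linarith)
    · have := h2 (g * x)
      rw [inv_mul_cancel_left] at this
      have := Real.log_le_log (hpos _) this
      rw [Real.log_mul hD.ne' (hpos _).ne'] at this
      exact le_max_of_le_right (by linarith)
  set χ := meanIncrement hM (fun x => Real.log (h x)) hψ
  have hχ : ∀ s, M (increment (fun x => Real.log (h x)) hψ s⁻¹) = -χ (Additive.ofMul s) := fun s => by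
    rw [← map_neg]; rfl
  have hlim := hμ.hasSum_one.sub (hc χ)
  rw [sub_zero] at hlim
  refine hasSum_le_of_sum_le hlim fun F => ?_
  have hMF : M (∑ s ∈ F, μ s • (1 + increment (fun x => Real.log (h x)) hψ s⁻¹))
      = ∑ s ∈ F, (μ s - χ (Additive.ofMul s) * μ s) := by
    rw [map_sum]
    refine Finset.sum_congr rfl fun s _ => ?_
    rw [map_smul, map_add, hM.map_one, hχ, smul_eq_mul]
    ring
  rw [← hMF]
  refine hM.le_of_forall_le fun x => ?_
  have hx := hpos x
  calc (∑ s ∈ F, μ s • (1 + increment (fun x => Real.log (h x)) hψ s⁻¹) : lp (fun _ : G => ℝ) ∞) x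
      = ∑ s ∈ F, μ s * (1 + (Real.log (h (s⁻¹ * x)) - Real.log (h x))) := by
        rw [lp.coeFn_sum, Finset.sum_apply]; rfl
    _ ≤ ∑ s ∈ F, μ s * (h (s⁻¹ * x) / h x) := by
        refine Finset.sum_le_sum fun s _ => mul_le_mul_of_nonneg_left ?_ (hμ.nonneg s)
        rw [← Real.log_div (hpos _).ne' hx.ne']
        linarith [Real.log_le_sub_one_of_pos (div_pos (hpos (s⁻¹ * x)) hx)]
    _ = (∑ s ∈ F, μ s * h (s⁻¹ * x)) / h x := by
        rw [Finset.sum_div]; exact Finset.sum_congr rfl fun s _ => by ring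
    _ ≤ t := (div_le_iff₀ hx).2 (sum_mul_greenFunction_le hμ hnd ht F x)

lemma walkSpectralRadius_eq_one (hμ : IsProbability μ) (hnd : IsNondegenerate μ)
    (ha : IsAmenable G) (hc : IsCentred μ) : walkSpectralRadius μ = 1 :=
  (walkSpectralRadius_le_one hμ).antisymm
    (le_of_forall_gt_imp_ge_of_dense fun _ ht =>
      one_le_of_isAmenable_of_isCentred hμ hnd ha hc ht)

/-! ### Non-centred measures -/

/-- A homomorphism to `ℝ` grows at most linearly in the word length. -/
lemma exists_abs_le_mul_wordLength (S : Finset G) (hS : Subgroup.closure (S : Set G) = ⊤)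
    (χ : Additive G →+ ℝ) :
    ∃ K : ℝ, 0 < K ∧ ∀ g, |χ (Additive.ofMul g)| ≤ K * wordLength (S : Set G) g := by
  have hK0 : 0 ≤ ∑ s ∈ S, |χ (Additive.ofMul s)| := Finset.sum_nonneg fun _ _ => abs_nonneg _
  set K := ∑ s ∈ S, |χ (Additive.ofMul s)|
  have hmem : ∀ s ∈ S, |χ (Additive.ofMul s)| ≤ K + 1 := fun s hs =>
    (Finset.single_le_sum (f := fun s => |χ (Additive.ofMul s)|) (fun _ _ => abs_nonneg _) hs).trans
      (by simp [K])
  have hlist : ∀ l : List G, (∀ x ∈ l, x ∈ (S : Set G) ∨ x⁻¹ ∈ (S : Set G)) →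
      |χ (Additive.ofMul l.prod)| ≤ (K + 1) * l.length := fun l => by
    induction l with
    | nil => simp
    | cons a l ih =>
      intro hl
      have ha : |χ (Additive.ofMul a)| ≤ K + 1 := by
        rcases hl a (by simp) with h | h
        · exact hmem a h
        · simpa using hmem _ h
      have hl' := ih fun x hx => hl x (by simp [hx])
      rw [List.prod_cons, ofMul_mul, map_add, List.length_cons]
      push_cast
      linarith [abs_add_le (χ (Additive.ofMul a)) (χ (Additive.ofMul l.prod))]
  refine ⟨K + 1, by positivity, fun g => ?_⟩
  have hne : {n : ℕ | ∃ l : List G, (∀ x ∈ l, x ∈ (S : Set G) ∨ x⁻¹ ∈ (S : Set G)) ∧ l.prod = g ∧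
      l.length = n}.Nonempty := by
    have hg : g ∈ (Subgroup.closure (S : Set G)).toSubmonoid := by rw [hS]; trivial
    rw [Subgroup.closure_toSubmonoid] at hg
    obtain ⟨l, hl, hg⟩ := Submonoid.exists_list_of_mem_closure hg
    exact ⟨_, l, hl, hg, rfl⟩
  obtain ⟨l, hl, hg, hlen⟩ := Nat.sInf_mem hne
  rw [wordLength, ← hlen, ← hg]
  exact hlist l hl

lemma exp_le_one_add_add_sq_mul_exp_abs (y : ℝ) :
    Real.exp y ≤ 1 + y + y ^ 2 * Real.exp |y| := by
  have h1 : 1 ≤ Real.exp |y| := Real.one_le_exp (abs_nonneg y)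
  rcases le_total |y| 1 with h | h
  · have := (abs_le.1 (Real.abs_exp_sub_one_sub_id_le h)).2
    nlinarith [sq_nonneg y]
  · rcases le_total 0 y with h0 | h0
    · rw [abs_of_nonneg h0] at *
      nlinarith [Real.exp_pos y, one_le_pow₀ h (n := 2)]
    · rw [abs_of_nonpos h0] at *
      have : Real.exp y ≤ 1 := Real.exp_le_one_iff.2 h0
      nlinarith

/-- If a homomorphism `χ` has exponential moments and mean `m ≠ 0`, then `∑ e^{tχ} μ < 1` for small
`t` of sign opposite to `m`. -/
lemma exists_hasSum_exp_lt_one (hμ : IsProbability μ) (χ : Additive G →+ ℝ) {a m : ℝ} (ha : 0 < a)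
    (hexp : Summable fun g => Real.exp (2 * a * |χ (Additive.ofMul g)|) * μ g)
    (hm : HasSum (fun g => χ (Additive.ofMul g) * μ g) m) (hm0 : m ≠ 0) :
    ∃ t F : ℝ, HasSum (fun g => Real.exp (t * χ (Additive.ofMul g)) * μ g) F ∧ F < 1 := by
  have hB0 : 0 ≤ ∑' g, Real.exp (2 * a * |χ (Additive.ofMul g)|) * μ g :=
    tsum_nonneg fun g => mul_nonneg (Real.exp_pos _).le (hμ.nonneg g)
  have hB := hexp.hasSum.mul_left (2 / a ^ 2)
  set B := 2 / a ^ 2 * ∑' g, Real.exp (2 * a * |χ (Additive.ofMul g)|) * μ g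
  have hB0 : 0 ≤ B := by positivity
  have hD : 0 < B + 1 + |m| / a := by positivity
  -- The exponent is `t = -τ m`; this `τ` ensures both `τ B < 1` and `|t| ≤ a`.
  set τ := 1 / (B + 1 + |m| / a) with hτ
  have hτ0 : 0 < τ := by positivity
  have hτB : τ * B < 1 := by
    rw [hτ, one_div_mul_eq_div, div_lt_one hD]
    linarith [show 0 ≤ |m| / a by positivity]
  have hτm : |(-(τ * m))| ≤ a := by
    rw [abs_neg, abs_mul, abs_of_pos hτ0, hτ, one_div_mul_eq_div, div_le_iff₀ hD]
    have : a * (|m| / a) = |m| := by field_simp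
    nlinarith
  set t := -(τ * m) with ht
  -- `e^{tχ} ≤ 1 + tχ + t²χ²e^{a|χ|}` and `χ² ≤ (2/a²) e^{a|χ|}`.
  have hpt : ∀ g, Real.exp (t * χ (Additive.ofMul g)) * μ g ≤ μ g + t * (χ (Additive.ofMul g) * μ g)
      + t ^ 2 * (2 / a ^ 2 * (Real.exp (2 * a * |χ (Additive.ofMul g)|) * μ g)) := fun g => by
    set y := χ (Additive.ofMul g)
    have h1 := exp_le_one_add_add_sq_mul_exp_abs (t * y)
    have h2 : Real.exp |t * y| ≤ Real.exp (a * |y|) := by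
      rw [abs_mul]; gcongr
    have h3 : y ^ 2 ≤ 2 / a ^ 2 * Real.exp (a * |y|) := by
      have := Real.quadratic_le_exp_of_nonneg (x := a * |y|) (by positivity)
      rw [div_mul_eq_mul_div, le_div_iff₀ (by positivity), ← sq_abs y]
      nlinarith [show 0 ≤ a * |y| by positivity]
    have h4 : Real.exp (2 * a * |y|) = Real.exp (a * |y|) * Real.exp (a * |y|) := by
      rw [← Real.exp_add]; ring_nf
    have h5 : (t * y) ^ 2 * Real.exp |t * y| ≤ t ^ 2 * (2 / a ^ 2 * Real.exp (2 * a * |y|)) := by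
      calc (t * y) ^ 2 * Real.exp |t * y|
          ≤ (t ^ 2 * (2 / a ^ 2 * Real.exp (a * |y|))) * Real.exp (a * |y|) := by
            rw [mul_pow]; gcongr
        _ = _ := by rw [h4]; ring
    calc Real.exp (t * y) * μ g
        ≤ (1 + t * y + t ^ 2 * (2 / a ^ 2 * Real.exp (2 * a * |y|))) * μ g :=
          mul_le_mul_of_nonneg_right (h1.trans (by linarith)) (hμ.nonneg g)
      _ = _ := by ring
  have hR := (hμ.hasSum_one.add (hm.mul_left t)).add (hB.mul_left (t ^ 2))
  have hs : Summable fun g => Real.exp (t * χ (Additive.ofMul g)) * μ g :=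
    .of_nonneg_of_le (fun g => mul_nonneg (Real.exp_pos _).le (hμ.nonneg g)) hpt hR.summable
  refine ⟨t, _, hs.hasSum, (hasSum_le hpt hs.hasSum hR).trans_lt ?_⟩
  have hmm : 0 < m ^ 2 := by positivity
  have : t * m + t ^ 2 * B = τ * m ^ 2 * (τ * B - 1) := by rw [ht]; ring
  have : τ * m ^ 2 * (τ * B - 1) < 0 := mul_neg_of_pos_of_neg (by positivity) (by linarith)
  linarith

lemma isCentred_of_walkSpectralRadius_eq_one (S : Finset G)
    (hS : Subgroup.closure (S : Set G) = ⊤) (hμ : IsProbability μ) {c : ℝ} (hc : 0 < c)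
    (hexp : HasExpMoment (S : Set G) μ c) (h : walkSpectralRadius μ = 1) : IsCentred μ := by
  intro χ
  obtain ⟨K, hK, hχ⟩ := exists_abs_le_mul_wordLength S hS χ
  obtain ⟨a, ha, hac⟩ : ∃ a : ℝ, 0 < a ∧ 2 * a * K = c := ⟨c / (2 * K), by positivity, by field_simp⟩
  have hexp' : Summable fun g => Real.exp (2 * a * |χ (Additive.ofMul g)|) * μ g := by
    refine .of_nonneg_of_le (fun g => mul_nonneg (Real.exp_pos _).le (hμ.nonneg g)) (fun g => ?_) hexp
    refine mul_le_mul_of_nonneg_right (Real.exp_le_exp.2 ?_) (hμ.nonneg g)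
    rw [← hac, mul_assoc _ K]
    exact mul_le_mul_of_nonneg_left (hχ g) (by positivity)
  have hs : Summable fun g => χ (Additive.ofMul g) * μ g := by
    refine .of_norm_bounded (hexp'.mul_left (2 * a)⁻¹) fun g => ?_
    rw [norm_mul, Real.norm_of_nonneg (hμ.nonneg g), Real.norm_eq_abs, ← mul_assoc]
    refine mul_le_mul_of_nonneg_right ?_ (hμ.nonneg g)
    rw [inv_mul_eq_div, le_div_iff₀ (by positivity)]
    linarith [Real.add_one_le_exp (2 * a * |χ (Additive.ofMul g)|)]
  by_contra hcon
  have hm0 : ∑' g, χ (Additive.ofMul g) * μ g ≠ 0 := fun h0 => hcon (h0 ▸ hs.hasSum)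
  obtain ⟨t, F, hF, hF1⟩ := exists_hasSum_exp_lt_one hμ χ ha hexp' hs.hasSum hm0
  let w : G →* ℝ :=
    { toFun := fun g => Real.exp (t * χ (Additive.ofMul g))
      map_one' := by simp
      map_mul' := fun g k => by rw [ofMul_mul, map_add, mul_add, Real.exp_add] }
  have hF0 : 0 ≤ F := hF.nonneg fun g => mul_nonneg (Real.exp_pos _).le (hμ.nonneg g)
  refine (walkSpectralRadius_lt_one_of_le hμ hF0 hF1 fun n => ?_).ne h
  have h1 := convPow_mul_le_pow hμ.nonneg w (fun g => Real.exp_pos _) hF n 1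
  rw [map_one, mul_one] at h1
  have h2 : 0 ≤ (n : ℝ) * F ^ n := by positivity
  linarith

/-! ### The regular representation and the Markov operator on `ℓ²(G)` -/

/-- The Hilbert space of square-summable real functions on `G`. -/
abbrev L2 (G : Type*) := lp (fun _ : G => ℝ) 2

lemma memℓp_two_iff {G : Type*} {f : G → ℝ} : Memℓp f 2 ↔ Summable fun x => f x ^ 2 := by
  rw [memℓp_gen_iff (by norm_num)]
  simp

lemma hasSum_sq {G : Type*} (f : L2 G) : HasSum (fun x => f x ^ 2) (‖f‖ ^ 2) := by
  have := lp.hasSum_inner (𝕜 := ℝ) f f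
  rw [real_inner_self_eq_norm_sq] at this
  simpa [pow_two] using this

/-- The left regular representation, `f ↦ f (s⁻¹ ·)`, on `ℓ²(G)`. -/
noncomputable def leftRegular (s : G) : L2 G →ₗᵢ[ℝ] L2 G where
  toFun f := ⟨fun x => f (s⁻¹ * x), memℓp_two_iff.2
    ((hasSum_sq f).summable.comp_injective (mul_right_injective s⁻¹))⟩
  map_add' _ _ := rfl
  map_smul' _ _ := rfl
  norm_map' f := by
    refine (pow_left_inj₀ (norm_nonneg _) (norm_nonneg _) two_ne_zero).1 ?_
    exact (hasSum_sq _).unique ((Equiv.mulLeft s⁻¹).hasSum_iff.2 (hasSum_sq f))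

lemma leftRegular_apply (s : G) (f : L2 G) (x : G) : leftRegular s f x = f (s⁻¹ * x) := rfl

lemma leftRegular_mul (g h : G) (f : L2 G) :
    leftRegular (g * h) f = leftRegular g (leftRegular h f) := by
  ext x
  simp only [leftRegular_apply, mul_inv_rev, mul_assoc]

/-- The operator of convolution by `μ` on `ℓ²(G)`. -/
noncomputable def markovOp (μ : G → ℝ) : L2 G →L[ℝ] L2 G :=
  ∑' s, μ s • (leftRegular s).toContinuousLinearMap

lemma norm_smul_leftRegular_le (hμ : IsProbability μ) (s : G) :
    ‖μ s • (leftRegular s).toContinuousLinearMap‖ ≤ μ s := by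
  rw [norm_smul, Real.norm_of_nonneg (hμ.nonneg s)]
  exact mul_le_of_le_one_right (hμ.nonneg s) (LinearIsometry.norm_toContinuousLinearMap_le _)

lemma hasSum_markovOp (hμ : IsProbability μ) :
    HasSum (fun s => μ s • (leftRegular s).toContinuousLinearMap) (markovOp μ) :=
  (Summable.of_norm_bounded hμ.hasSum_one.summable (norm_smul_leftRegular_le hμ)).hasSum

lemma hasSum_markovOp_apply (hμ : IsProbability μ) (f : L2 G) :
    HasSum (fun s => μ s • leftRegular s f) (markovOp μ f) :=
  (hasSum_markovOp hμ).mapL (ContinuousLinearMap.apply ℝ (L2 G) f)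

lemma norm_markovOp_le (hμ : IsProbability μ) : ‖markovOp μ‖ ≤ 1 :=
  tsum_of_norm_bounded hμ.hasSum_one (norm_smul_leftRegular_le hμ)

lemma markovOp_apply_apply (hμ : IsProbability μ) (f : L2 G) (x : G) :
    markovOp μ f x = conv μ f x :=
  ((hasSum_markovOp_apply hμ f).mapL (lp.evalCLM ℝ (fun _ : G => ℝ) 2 x)).tsum_eq.symm

open Classical in
lemma markovOp_pow_single (hμ : IsProbability μ) (n : ℕ) :
    ⇑((markovOp μ ^ n) (lp.single 2 (1 : G) (1 : ℝ))) = convPow μ n := by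
  induction n with
  | zero =>
    ext x
    simp [convPow, lp.single_apply, Pi.single_apply]
  | succ n ih =>
    ext x
    rw [pow_succ', mul_apply_eq_comp, markovOp_apply_apply hμ, ih]
    rfl

/-- The matrix coefficient of `(1 + P)²ⁿ` at the identity dominates the middle term
`C(2n, n) μ^{∗n}(e)` of its binomial expansion. -/
lemma centralBinom_mul_convPow_le (hμ : IsProbability μ) (n : ℕ) :
    (n.centralBinom : ℝ) * convPow μ n 1 ≤ ‖1 + markovOp μ‖ ^ (2 * n) := by
  classical
  set δ : L2 G := lp.single 2 (1 : G) (1 : ℝ) with hδ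
  have hδ1 : ‖δ‖ = 1 := by rw [hδ, lp.norm_single (by norm_num)]; simp
  have hexp : ((1 + markovOp μ) ^ (2 * n)) δ 1
      = ∑ k ∈ Finset.range (2 * n + 1), ((2 * n).choose k : ℝ) * convPow μ k 1 := by
    rw [add_comm, (Commute.one_right (markovOp μ)).add_pow, sum_apply,
      lp.coeFn_sum, Finset.sum_apply]
    refine Finset.sum_congr rfl fun k _ => ?_
    rw [one_pow, mul_one, ← nsmul_eq_mul', smul_apply,
      ← Nat.cast_smul_eq_nsmul ℝ, lp.coeFn_smul, Pi.smul_apply, markovOp_pow_single hμ, smul_eq_mul]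
  calc (n.centralBinom : ℝ) * convPow μ n 1
      ≤ ∑ k ∈ Finset.range (2 * n + 1), ((2 * n).choose k : ℝ) * convPow μ k 1 :=
        Finset.single_le_sum (f := fun k => ((2 * n).choose k : ℝ) * convPow μ k 1)
          (fun k _ => mul_nonneg (Nat.cast_nonneg _) (convPow_nonneg hμ.nonneg _ _))
          (Finset.mem_range.2 (by lia))
    _ = ((1 + markovOp μ) ^ (2 * n)) δ 1 := hexp.symm
    _ ≤ ‖((1 + markovOp μ) ^ (2 * n)) δ‖ :=
        (Real.le_norm_self _).trans (lp.norm_apply_le_norm two_ne_zero _ _)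
    _ ≤ ‖(1 + markovOp μ) ^ (2 * n)‖ := by
        simpa [hδ1] using ((1 + markovOp μ) ^ (2 * n)).le_opNorm δ
    _ ≤ _ := by
        rcases Nat.eq_zero_or_pos n with rfl | hn
        · rw [mul_zero, pow_zero, pow_zero]
          exact ContinuousLinearMap.norm_id_le
        · exact norm_pow_le' _ (by lia)

lemma two_le_norm_one_add_markovOp (hμ : IsProbability μ) (h : walkSpectralRadius μ = 1) :
    2 ≤ ‖1 + markovOp μ‖ := by
  by_contra! hlt
  have h0 := norm_nonneg (1 + markovOp μ)
  refine (walkSpectralRadius_lt_one_of_le hμ (r := ‖1 + markovOp μ‖ ^ 2 / 4) (by positivity)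
    (by nlinarith) fun n => ?_).ne h
  have h1 := centralBinom_mul_convPow_le hμ n
  have h2 : (4 : ℝ) ^ n ≤ (2 * n + 1) * n.centralBinom := by
    exact_mod_cast Nat.four_pow_le_two_mul_add_one_mul_central_binom n
  rw [div_pow, ← pow_mul, ← mul_div_assoc, le_div_iff₀ (by positivity)]
  calc convPow μ n 1 * 4 ^ n ≤ convPow μ n 1 * ((2 * n + 1) * n.centralBinom) :=
        mul_le_mul_of_nonneg_left h2 (convPow_nonneg hμ.nonneg _ _)
    _ = (2 * n + 1) * (n.centralBinom * convPow μ n 1) := by ring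
    _ ≤ _ := by gcongr

/-! ### Almost invariant vectors -/

/-- If `f` is a unit vector with `‖f + P f‖` close to `2`, then `f` is almost fixed by each element
of the support: `1 - ⟪f, P f⟫` is the average of the nonnegative numbers `‖λ(s) f - f‖² / 2`. -/
lemma mul_norm_leftRegular_sub_sq_le (hμ : IsProbability μ) {f : L2 G} (hf : ‖f‖ = 1) (s : G) :
    μ s * ‖leftRegular s f - f‖ ^ 2 ≤ 4 - ‖f + markovOp μ f‖ ^ 2 := by
  have h1 : HasSum (fun s => μ s * inner ℝ f (leftRegular s f)) (inner ℝ f (markovOp μ f)) := by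
    simpa [inner_smul_right] using (hasSum_markovOp_apply hμ f).mapL (innerSL ℝ f)
  have hsq : ∀ s, ‖leftRegular s f - f‖ ^ 2 = 2 - 2 * inner ℝ f (leftRegular s f) := fun s => by
    rw [norm_sub_sq_real, (leftRegular s).norm_map, hf, real_inner_comm]
    ring
  have h2 : HasSum (fun s => μ s * ‖leftRegular s f - f‖ ^ 2)
      (2 * 1 - 2 * inner ℝ f (markovOp μ f)) := by
    refine ((hμ.hasSum_one.mul_left 2).sub (h1.mul_left 2)).congr_fun fun s => ?_
    rw [hsq]
    ring
  have h3 : ‖markovOp μ f‖ ≤ 1 := by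
    simpa [hf] using (markovOp μ).le_of_opNorm_le (norm_markovOp_le hμ) f
  have h4 := norm_add_sq_real f (markovOp μ f)
  rw [hf] at h4
  have h5 := le_hasSum h2 s fun s _ => mul_nonneg (hμ.nonneg s) (sq_nonneg _)
  nlinarith [norm_nonneg (markovOp μ f)]

lemma exists_norm_one_lt_norm_add (h : 2 ≤ ‖1 + markovOp μ‖) {ε : ℝ} (hε : 0 < ε) (hε2 : ε < 2) :
    ∃ f : L2 G, ‖f‖ = 1 ∧ 2 - ε < ‖f + markovOp μ f‖ := by
  obtain ⟨f, hf1, hf⟩ := ContinuousLinearMap.exists_lt_apply_of_lt_opNorm (1 + markovOp μ)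
    (show 2 - ε < ‖1 + markovOp μ‖ by linarith)
  have hf0 : f ≠ 0 := by
    rintro rfl
    simp at hf
    linarith
  have hpos := norm_pos_iff.2 hf0
  refine ⟨‖f‖⁻¹ • f, by rw [norm_smul, norm_inv, norm_norm, inv_mul_cancel₀ hpos.ne'], hf.trans_le ?_⟩
  rw [map_smul, ← smul_add, norm_smul, norm_inv, norm_norm]
  exact le_mul_of_one_le_left (norm_nonneg _) ((one_le_inv₀ hpos).2 hf1.le)

lemma exists_almost_invariant (hμ : IsProbability μ) (hnd : IsNondegenerate μ)
    (h : walkSpectralRadius μ = 1) :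
    ∃ f : ℕ → L2 G, (∀ k, ‖f k‖ = 1) ∧
      ∀ g, Tendsto (fun k => ‖leftRegular g (f k) - f k‖) atTop (nhds 0) := by
  have h2 := two_le_norm_one_add_markovOp hμ h
  choose f hf1 hf2 using fun k : ℕ => exists_norm_one_lt_norm_add h2
    (ε := 1 / ((k : ℝ) + 1)) (by positivity)
    (by rw [div_lt_iff₀ (by positivity)]; linarith [Nat.cast_nonneg (α := ℝ) k])
  refine ⟨f, hf1, hnd.induction (fun s hs => ?_) fun g h hg hh => ?_⟩
  · have hsq : Tendsto (fun k => ‖leftRegular s (f k) - f k‖ ^ 2) atTop (nhds 0) := by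
      refine squeeze_zero (fun k => sq_nonneg _) (g := fun k : ℕ => 4 / μ s * (1 / ((k : ℝ) + 1)))
        (fun k => ?_) (by simpa using tendsto_one_div_add_atTop_nhds_zero_nat.const_mul (4 / μ s))
      have h1 := mul_norm_leftRegular_sub_sq_le hμ (hf1 k) s
      have h3 := hf2 k
      have hε : 0 < 1 / ((k : ℝ) + 1) := by positivity
      have hε1 : 1 / ((k : ℝ) + 1) ≤ 1 := by
        rw [div_le_one (by positivity)]; linarith [Nat.cast_nonneg (α := ℝ) k]
      rw [div_mul_eq_mul_div, le_div_iff₀ hs]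
      nlinarith
    simpa [Real.sqrt_sq (norm_nonneg _)] using hsq.sqrt
  · refine squeeze_zero (fun k => norm_nonneg _) (fun k => ?_) (by simpa using hh.add hg)
    calc ‖leftRegular (g * h) (f k) - f k‖
        = ‖leftRegular g (leftRegular h (f k) - f k) + (leftRegular g (f k) - f k)‖ := by
          rw [leftRegular_mul, map_sub]; abel_nf
      _ ≤ _ := (norm_add_le _ _).trans_eq (by rw [(leftRegular g).norm_map])

/-! ### From almost invariant vectors to a Banach mean -/

/-- Pointwise multiplication of a square-summable function by a bounded one. -/
noncomputable def mulBounded {G : Type*} (φ : lp (fun _ : G => ℝ) ∞) (f : L2 G) : L2 G :=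
  ⟨fun x => φ x * f x, memℓp_two_iff.2 (by
    refine .of_nonneg_of_le (fun x => sq_nonneg _) (fun x => ?_)
      ((hasSum_sq f).summable.mul_left (‖φ‖ ^ 2))
    rw [mul_pow, ← sq_abs (φ x)]
    have := lp.norm_apply_le_norm ENNReal.top_ne_zero φ x
    rw [Real.norm_eq_abs] at this
    gcongr)⟩

lemma mulBounded_apply {G : Type*} (φ : lp (fun _ : G => ℝ) ∞) (f : L2 G) (x : G) :
    mulBounded φ f x = φ x * f x := rfl

lemma norm_mulBounded_le {G : Type*} (φ : lp (fun _ : G => ℝ) ∞) (f : L2 G) :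
    ‖mulBounded φ f‖ ≤ ‖φ‖ * ‖f‖ := by
  refine (sq_le_sq₀ (norm_nonneg _) (by positivity)).1 ?_
  rw [mul_pow]
  refine hasSum_le (fun x => ?_) (hasSum_sq _) ((hasSum_sq f).mul_left (‖φ‖ ^ 2))
  rw [mulBounded_apply, mul_pow, ← sq_abs (φ x)]
  have := lp.norm_apply_le_norm ENNReal.top_ne_zero φ x
  rw [Real.norm_eq_abs] at this
  gcongr

lemma hasSum_inner_mulBounded {G : Type*} (φ : lp (fun _ : G => ℝ) ∞) (f : L2 G) :
    HasSum (fun x => φ x * f x ^ 2) (inner ℝ (mulBounded φ f) f) := by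
  refine (lp.hasSum_inner (𝕜 := ℝ) (mulBounded φ f) f).congr_fun fun x => ?_
  simp [mulBounded_apply]
  ring

lemma inner_mulBounded_le_iSup {G : Type*} (φ : lp (fun _ : G => ℝ) ∞) {f : L2 G} (hf : ‖f‖ = 1) :
    inner ℝ (mulBounded φ f) f ≤ ⨆ g, φ g := by
  have hb : BddAbove (Set.range φ) := ⟨‖φ‖, by
    rintro _ ⟨x, rfl⟩
    exact (le_abs_self _).trans (lp.norm_apply_le_norm ENNReal.top_ne_zero φ x)⟩
  have h1 := (hasSum_sq f).mul_left (⨆ g, φ g)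
  rw [hf, one_pow, mul_one] at h1
  exact hasSum_le (fun x => mul_le_mul_of_nonneg_right (le_ciSup hb x) (sq_nonneg _))
    (hasSum_inner_mulBounded φ f) h1

lemma iInf_le_inner_mulBounded {G : Type*} (φ : lp (fun _ : G => ℝ) ∞) {f : L2 G} (hf : ‖f‖ = 1) :
    ⨅ g, φ g ≤ inner ℝ (mulBounded φ f) f := by
  have hb : BddBelow (Set.range φ) := ⟨-‖φ‖, by
    rintro _ ⟨x, rfl⟩
    exact neg_le_of_abs_le (lp.norm_apply_le_norm ENNReal.top_ne_zero φ x)⟩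
  have h1 := (hasSum_sq f).mul_left (⨅ g, φ g)
  rw [hf, one_pow, mul_one] at h1
  exact hasSum_le (fun x => mul_le_mul_of_nonneg_right (ciInf_le hb x) (sq_nonneg _))
    h1 (hasSum_inner_mulBounded φ f)

lemma leftRegular_mulBounded_translate (g : G) (φ : lp (fun _ : G => ℝ) ∞) (f : L2 G) :
    leftRegular g (mulBounded (translate g φ) f) = mulBounded φ (leftRegular g f) := by
  ext x
  simp [leftRegular_apply, mulBounded_apply, translate]

lemma abs_inner_mulBounded_translate_sub_le (g : G) (φ : lp (fun _ : G => ℝ) ∞) {f : L2 G}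
    (hf : ‖f‖ = 1) :
    |inner ℝ (mulBounded (translate g φ) f) f - inner ℝ (mulBounded φ f) f|
      ≤ 2 * ‖φ‖ * ‖leftRegular g f - f‖ := by
  set u := leftRegular g f
  have hu : ‖u‖ = 1 := by rw [(leftRegular g).norm_map, hf]
  have h1 : inner ℝ (mulBounded (translate g φ) f) f = inner ℝ (mulBounded φ u) u := by
    rw [← leftRegular_mulBounded_translate, (leftRegular g).inner_map_map]
  have h2 : mulBounded φ u = mulBounded φ (u - f) + mulBounded φ f := by
    ext x
    change φ x * u x = φ x * (u x - f x) + φ x * f x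
    ring
  have h3 : inner ℝ (mulBounded φ u) u - inner ℝ (mulBounded φ f) f
      = inner ℝ (mulBounded φ (u - f)) u + inner ℝ (mulBounded φ f) (u - f) := by
    rw [h2, inner_add_left, inner_sub_right]
    ring
  rw [h1, h3]
  have h4 := (abs_real_inner_le_norm (mulBounded φ (u - f)) u)
  have h5 := (abs_real_inner_le_norm (mulBounded φ f) (u - f))
  have h6 := norm_mulBounded_le φ (u - f)
  have h7 := norm_mulBounded_le φ f
  rw [hu, mul_one] at h4
  rw [hf, mul_one] at h7
  have h8 := mul_le_mul_of_nonneg_right h7 (norm_nonneg (u - f))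
  linarith [abs_add_le (inner ℝ (mulBounded φ (u - f)) u) (inner ℝ (mulBounded φ f) (u - f))]

/-- The mean is the limit along a non-principal ultrafilter of the averages against the probability
densities `f k ^ 2`. -/
lemma isAmenable_of_almost_invariant {f : ℕ → L2 G} (hf : ∀ k, ‖f k‖ = 1)
    (hinv : ∀ g, Tendsto (fun k => ‖leftRegular g (f k) - f k‖) atTop (nhds 0)) :
    IsAmenable G := by
  have hU : (hyperfilter ℕ : Filter ℕ) ≤ atTop := Nat.hyperfilter_le_atTop
  have hex : ∀ φ : lp (fun _ : G => ℝ) ∞, ∃ a ∈ Set.Icc (⨅ g, φ g) (⨆ g, φ g),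
      Tendsto (fun k => inner ℝ (mulBounded φ (f k)) (f k)) (hyperfilter ℕ) (nhds a) := fun φ =>
    isCompact_Icc.ultrafilter_le_nhds ((hyperfilter ℕ).map _) (tendsto_principal.2
      (Eventually.of_forall fun k => ⟨iInf_le_inner_mulBounded φ (hf k),
        inner_mulBounded_le_iSup φ (hf k)⟩))
  choose M hM hlim using hex
  let L : lp (fun _ : G => ℝ) ∞ →ₗ[ℝ] ℝ :=
    { toFun := M
      map_add' := fun φ ψ => by
        refine tendsto_nhds_unique (hlim _) (((hlim φ).add (hlim ψ)).congr fun k => ?_)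
        rw [← inner_add_left]
        congr 1
        ext x
        exact (add_mul _ _ _).symm
      map_smul' := fun c φ => by
        refine tendsto_nhds_unique (hlim _) (((hlim φ).const_mul c).congr fun k => ?_)
        rw [← real_inner_smul_left]
        congr 1
        ext x
        exact (mul_assoc _ _ _).symm }
  refine ⟨L, ⟨?_, fun φ => (hM φ).1, fun φ => (hM φ).2, fun g φ => ?_⟩⟩
  · have h1 := hM 1
    simp only [lp.infty_coeFn_one, Pi.one_apply, ciSup_const, ciInf_const, Set.Icc_self,
      Set.mem_singleton_iff] at h1
    exact h1
  · have h0 : Tendsto (fun k => inner ℝ (mulBounded (translate g φ) (f k)) (f k)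
        - inner ℝ (mulBounded φ (f k)) (f k)) (hyperfilter ℕ) (nhds 0) := by
      refine squeeze_zero_norm (fun k => abs_inner_mulBounded_translate_sub_le g φ (hf k)) ?_
      simpa using ((hinv g).mono_left hU).const_mul (2 * ‖φ‖)
    exact sub_eq_zero.1 (tendsto_nhds_unique ((hlim _).sub (hlim φ)) h0)

end GroupWalk

theorem corollary1p2 {G : Type*} [Group G] (S : Finset G)
    (hS : Subgroup.closure (S : Set G) = ⊤)
    (μ : G → ℝ) (hμ : GroupWalk.IsProbability μ)
    (hnd : GroupWalk.IsNondegenerate μ)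
    (hexp : ∃ c : ℝ, 0 < c ∧ GroupWalk.HasExpMoment (S : Set G) μ c) :
    GroupWalk.walkSpectralRadius μ = 1 ↔ GroupWalk.IsAmenable G ∧ GroupWalk.IsCentred μ := by
  obtain ⟨c, hc, hexp⟩ := hexp
  refine ⟨fun h => ⟨?_, ?_⟩, fun ⟨ha, hcen⟩ => GroupWalk.walkSpectralRadius_eq_one hμ hnd ha hcen⟩
  · obtain ⟨f, hf, hinv⟩ := GroupWalk.exists_almost_invariant hμ hnd h
    exact GroupWalk.isAmenable_of_almost_invariant hf hinv
  · exact GroupWalk.isCentred_of_walkSpectralRadius_eq_one S hS hμ hc hexp h
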